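/- There is a universal constant $C>0$ such that the following holds. Let $d\geqslant 1$ be an integer and, for $\ell=1,\dots,d$, let $0\leqslant r_\ell\leqslant n_\ell$ be integers. Let $\mathscr N$ be a random real tensor of size $n_1\times\dots\times n_d$ whose entries are independent standard normal $\mathcal N(0,1)$ random variables. Denote by $V_{r}(\mathbb R^{n})=\{A\in\mathbb R^{n\times r}\mid A^\top A=I_{r}\}$ the set of $n\times r$ matrices with orthonormal columns and, for $A^{(\ell)}\in\mathbb R^{n_\ell\times r_\ell}$, by $\mathscr N(A^{(1)},\dots,A^{(d)})$ the $r_1\times\dots\times r_d$ tensor with entries \[ [\mathscr N(A^{(1)},\dots,A^{(d)})]_{j_1,\dots,j_d}=\sum_{i_1=1}^{n_1}\cdots\sum_{i_d=1}^{n_d}\mathscr N_{i_1,\dots,i_d}\prod_{\ell=1}^d A^{(\ell)}_{i_\ell,j_\ell}. \] Let $\|\cdot\|_{\mathrm F}$ be the Frobenius norm of a tensor, i.e. the square root of the sum of its squared entries. Then, for every $\delta>0$, with probability at least $1-\delta$, \[ \sup_{A^{(\ell)}\in V_{r_\ell}(\mathbb R^{n_\ell}),\ \ell=1,\dots,d}\left\|\mathscr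 N(A^{(1)},\dots,A^{(d)})\right\|_{\mathrm F}^2 \leqslant 16\left[\left(\sum_{\ell=1}^d r_\ell\left(n_\ell-\frac{r_\ell+1}{2}\right)\right)\log\frac{Cd}{\log\frac32}+\log\left(\frac1\delta\max\left(1,e^{\frac12\prod_{\ell=1}^d r_\ell-1}\right)\right)\right]. \] -/

import Mathlib

open MeasureTheory ProbabilityTheory
open scoped Matrix BigOperators ENNReal

/-- Real tensors of size `n 0 × ⋯ × n (d - 1)`, as multi-way arrays. -/
abbrev Tensor {d : ℕ} (n : Fin d → ℕ) : Type :=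
  ((l : Fin d) → Fin (n l)) → ℝ

/-- The scalar product of two tensors of the same size. -/
noncomputable def tensorInner {d : ℕ} {n : Fin d → ℕ} (S T : Tensor n) : ℝ :=
  ∑ i, S i * T i

/-- The Frobenius norm of a tensor. -/
noncomputable def frobNorm {d : ℕ} {n : Fin d → ℕ} (T : Tensor n) : ℝ :=
  Real.sqrt (tensorInner T T)

/-- The contraction `T(A 0, …, A (d - 1))` of a tensor `T` on matrices `A l` of size
`n l × p l`: its entry at `j` is `∑ i, T i * ∏ l, A l (i l) (j l)`. -/
noncomputable def contraction {d : ℕ} {n p : Fin d → ℕ} (T : Tensor n)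
    (A : (l : Fin d) → Matrix (Fin (n l)) (Fin (p l)) ℝ) : Tensor p :=
  fun j => ∑ i : (l : Fin d) → Fin (n l), T i * ∏ l, A l (i l) (j l)

/-- The Stiefel manifold `V_r(ℝⁿ)` of `n × r` real matrices with orthonormal columns. -/
def stiefel (n r : ℕ) : Set (Matrix (Fin n) (Fin r) ℝ) :=
  {U | Uᵀ * U = 1}

/-! ### Volumetric nets in finite-dimensional normed spaces -/

section Nets

open Module Metric Set

/-! The norm of the contraction depends on each `A l` only through its column span, and replacing `A
l` by `A l * H` multiplies it by at most ‖H‖. So it suffices to net column spans. Charts of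
dimension r(n-r) around a coarse net give (5625/ε)^k frames, where k = r(n-r) + r(r-1)/2 =
r(n-(r+1)/2) (`exists_stiefel_net`). With ε = 1/(2d), moving all d factors to net points loses at
most half the supremum, which is therefore at most twice the maximum over the net
(`frobNorm_contraction_le_two_mul`).

For fixed factors the squared norm has exponential moment √2^p at parameter 1/4, p = ∏ r
(`lintegral_exp_frobNorm_contraction`). Markov and a union bound give (11250 d)^K √2^p exp(-t/16)
with K = ∑ k. Since √2^p ≤ 3 max(1, e^(p/2-1)) and 3 ≤ 3^K for K ≥ 1, the constant C = 3 · 11250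
suffices. For K = 0 nothing absorbs the 3, and a sharp scalar Gaussian tail replaces the union
bound. -/

theorem card_le_of_separated_of_norm_le {E : Type*} [NormedAddCommGroup E] [NormedSpace ℝ E]
    [FiniteDimensional ℝ E] {R ε : ℝ} (hR : 0 ≤ R) (hε : 0 < ε) (s : Finset E)
    (hs : ∀ c ∈ s, ‖c‖ ≤ R) (h : ∀ c ∈ s, ∀ d ∈ s, c ≠ d → ε ≤ ‖c - d‖) :
    (s.card : ℝ) ≤ (1 + 2 * R / ε) ^ finrank ℝ E := by
  borelize E
  let μ : Measure E := Measure.addHaar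
  have hδ : 0 < ε / 2 := by positivity
  have hρ : 0 < ε / 2 + R := by positivity
  -- Disjoint balls of radius ε/2 inside a ball of radius R + ε/2: comparing Haar volumes bounds
  -- their number.
  have hdisj : Set.Pairwise (s : Set E) (Function.onFun Disjoint fun c => ball (c : E) (ε / 2)) := by
    rintro c hc d hd hcd
    apply ball_disjoint_ball
    rw [dist_eq_norm]
    linarith [h c hc d hd hcd]
  have hsub : (⋃ c ∈ s, ball (c : E) (ε / 2)) ⊆ ball (0 : E) (ε / 2 + R) := by
    refine iUnion₂_subset fun x hx => ball_subset_ball' ?_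
    rw [dist_zero_right]
    linarith [hs x hx]
  have I : (s.card : ℝ≥0∞) * ENNReal.ofReal ((ε / 2) ^ finrank ℝ E) * μ (ball 0 1) ≤
      ENNReal.ofReal ((ε / 2 + R) ^ finrank ℝ E) * μ (ball 0 1) := by
    have h1 := measure_biUnion_finset (μ := μ) hdisj fun c _ => measurableSet_ball
    have h2 := measure_mono (μ := μ) hsub
    rw [h1] at h2
    simp only [μ.addHaar_ball_of_pos _ hδ, μ.addHaar_ball_of_pos _ hρ, Finset.sum_const,
      nsmul_eq_mul, ← mul_assoc] at h2
    exact h2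
  have J : (s.card : ℝ≥0∞) * ENNReal.ofReal ((ε / 2) ^ finrank ℝ E) ≤
      ENNReal.ofReal ((ε / 2 + R) ^ finrank ℝ E) :=
    (ENNReal.mul_le_mul_iff_left (measure_ball_pos _ _ zero_lt_one).ne' measure_ball_lt_top.ne).1 I
  have K := ENNReal.toReal_le_of_le_ofReal (pow_nonneg hρ.le _) J
  rw [ENNReal.toReal_mul, ENNReal.toReal_natCast, ENNReal.toReal_ofReal (by positivity)] at K
  have e : 1 + 2 * R / ε = (ε / 2 + R) / (ε / 2) := by field_simp
  rw [e, div_pow, le_div_iff₀ (by positivity)]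
  exact K

/-- A separated subset of `s` of maximal cardinality is a net, since an uncovered point could be
added to it. The packing bound makes the maximum exist. -/
theorem exists_finset_net_of_norm_le {E : Type*} [NormedAddCommGroup E] [NormedSpace ℝ E]
    [FiniteDimensional ℝ E] {R ε : ℝ} (hR : 0 ≤ R) (hε : 0 < ε) (s : Set E)
    (hs : ∀ c ∈ s, ‖c‖ ≤ R) :
    ∃ t : Finset E, ↑t ⊆ s ∧ (t.card : ℝ) ≤ (1 + 2 * R / ε) ^ finrank ℝ E ∧
      ∀ x ∈ s, ∃ y ∈ t, ‖x - y‖ ≤ ε := by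
  classical
  let Q : ℕ → Prop := fun k => ∃ t : Finset E, ↑t ⊆ s ∧
    (∀ c ∈ t, ∀ d ∈ t, c ≠ d → ε ≤ ‖c - d‖) ∧ t.card = k
  have hQ : ∀ k, Q k → k ≤ ⌊(1 + 2 * R / ε) ^ finrank ℝ E⌋₊ := by
    rintro k ⟨t, hts, hsep, rfl⟩
    exact Nat.le_floor (card_le_of_separated_of_norm_le hR hε t (fun c hc => hs c (hts hc)) hsep)
  have hQ0 : Q 0 := ⟨∅, by simp, by simp, by simp⟩
  obtain ⟨t, hts, hsep, htc⟩ := Nat.findGreatest_spec (hQ 0 hQ0) hQ0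
  refine ⟨t, hts, card_le_of_separated_of_norm_le hR hε t (fun c hc => hs c (hts hc)) hsep, ?_⟩
  intro x hx
  by_contra! hcon
  have hxt : x ∉ t := fun hxt => by
    have := hcon x hxt
    rw [sub_self, norm_zero] at this
    linarith
  have hQ1 : Q (t.card + 1) := by
    refine ⟨insert x t, ?_, ?_, Finset.card_insert_of_notMem hxt⟩
    · rw [Finset.coe_insert]
      exact insert_subset hx hts
    · intro c hc d hd hcd
      rcases Finset.mem_insert.1 hc with hcx | hct <;> rcases Finset.mem_insert.1 hd with hdx | hdt
      · exact absurd (hcx.trans hdx.symm) hcd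
      · exact hcx ▸ (hcon d hdt).le
      · rw [norm_sub_rev]
        exact hdx ▸ (hcon c hct).le
      · exact hsep c hct d hdt hcd
  have := Nat.le_findGreatest (P := Q) (hQ _ hQ1) hQ1
  omega

end Nets

/-! ### Operator norms and orthonormal frames -/

section StiefelNets

open scoped Matrix.Norms.L2Operator

theorem Matrix.l2_opNorm_transpose {m n : Type*} [Fintype m] [Fintype n] [DecidableEq m]
    [DecidableEq n] (A : Matrix m n ℝ) : ‖Aᵀ‖ = ‖A‖ := by
  rw [← Matrix.conjTranspose_eq_transpose_of_trivial, Matrix.l2_opNorm_conjTranspose]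

theorem Matrix.l2_opNorm_one_le {m : Type*} [Fintype m] [DecidableEq m] :
    ‖(1 : Matrix m m ℝ)‖ ≤ 1 := by
  rw [← Matrix.diagonal_one, Matrix.l2_opNorm_diagonal]
  exact (pi_norm_le_iff_of_nonneg zero_le_one).2 fun i => by simp

theorem norm_le_one_of_mem_stiefel {n r : ℕ} {A : Matrix (Fin n) (Fin r) ℝ}
    (hA : A ∈ stiefel n r) : ‖A‖ ≤ 1 := by
  have h := Matrix.l2_opNorm_conjTranspose_mul_self A
  rw [Matrix.conjTranspose_eq_transpose_of_trivial, show Aᵀ * A = 1 from hA] at h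
  have h1 := Matrix.l2_opNorm_one_le (m := Fin r)
  nlinarith [norm_nonneg A]

/-- An orthonormal frame whose span contains the columns of `M`, which may be linearly dependent. -/
theorem exists_stiefel_mul_transpose_mul {n r : ℕ} (hrn : r ≤ n) (M : Matrix (Fin n) (Fin r) ℝ) :
    ∃ W ∈ stiefel n r, W * (Wᵀ * M) = M := by
  -- Zero padding gives n vectors, so Gram–Schmidt yields a basis of the whole space. By
  -- triangularity each of the first r vectors involves only the first r basis vectors.
  let f : Fin n → EuclideanSpace ℝ (Fin n) := fun k =>
    if h : (k : ℕ) < r then WithLp.toLp 2 (fun i => M i ⟨k, h⟩) else 0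
  let b := InnerProductSpace.gramSchmidtOrthonormalBasis (𝕜 := ℝ)
    (finrank_euclideanSpace (𝕜 := ℝ) (ι := Fin n)) f
  have hin : ∀ x y : EuclideanSpace ℝ (Fin n), inner ℝ x y = ∑ i, x i * y i := by
    intro x y
    simp [PiLp.inner_apply, mul_comm]
  let W : Matrix (Fin n) (Fin r) ℝ := Matrix.of fun i k => b (Fin.castLE hrn k) i
  refine ⟨W, ?_, ?_⟩
  · change Wᵀ * W = 1
    ext j k
    have h := orthonormal_iff_ite.1 b.orthonormal (Fin.castLE hrn j) (Fin.castLE hrn k)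
    rw [hin] at h
    rw [Matrix.mul_apply, Matrix.one_apply]
    simpa [W] using h
  · ext i k
    have hf : f (Fin.castLE hrn k) = WithLp.toLp 2 (fun i => M i k) := by simp [f]
    have hrep := b.sum_repr' (f (Fin.castLE hrn k))
    have hzero : ∀ j : Fin n, r ≤ (j : ℕ) → inner ℝ (b j) (f (Fin.castLE hrn k)) = 0 := by
      intro j hj
      exact InnerProductSpace.gramSchmidtOrthonormalBasis_inv_triangular _ f
        (Fin.lt_def.2 (lt_of_lt_of_le k.2 hj))
    have hi := congrArg (fun v : EuclideanSpace ℝ (Fin n) => v i) hrep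
    simp only [WithLp.ofLp_sum, Finset.sum_apply, PiLp.smul_apply, smul_eq_mul] at hi
    have hM : (f (Fin.castLE hrn k)) i = M i k := by rw [hf]
    rw [hM] at hi
    rw [← hi, Matrix.mul_apply]
    have hco : ∀ j : Fin r, (Wᵀ * M) j k =
        inner ℝ (b (Fin.castLE hrn j)) (f (Fin.castLE hrn k)) := by
      intro j
      rw [hin, hf, Matrix.mul_apply]
      rfl
    have hinj : Function.Injective (Fin.castLE hrn) := Fin.castLE_injective hrn
    symm
    calc ∑ j, inner ℝ (b j) (f (Fin.castLE hrn k)) * (b j) i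
        = ∑ j ∈ Finset.univ.map ⟨Fin.castLE hrn, hinj⟩,
            inner ℝ (b j) (f (Fin.castLE hrn k)) * (b j) i := by
          symm
          apply Finset.sum_subset (Finset.subset_univ _)
          intro j _ hj
          rw [hzero j, zero_mul]
          by_contra! hlt
          exact hj (Finset.mem_map.2 ⟨⟨j, hlt⟩, Finset.mem_univ _, by ext; rfl⟩)
      _ = ∑ j : Fin r, W i j * (Wᵀ * M) j k := by
          rw [Finset.sum_map]
          refine Finset.sum_congr rfl fun j _ => ?_
          rw [hco, mul_comm]
          rfl

end StiefelNets

/-! ### Nets of column spans -/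

section GrassmannNets

open Module
open scoped Matrix.Norms.L2Operator

theorem finrank_ker_transpose_mul {n r : ℕ} {B : Matrix (Fin n) (Fin r) ℝ}
    (hB : B ∈ stiefel n r) (L : Matrix (Fin n) (Fin r) ℝ →ₗ[ℝ] Matrix (Fin r) (Fin r) ℝ)
    (hL : ∀ X, L X = Bᵀ * X) : finrank ℝ (LinearMap.ker L) = r * (n - r) := by
  have hB' : Bᵀ * B = 1 := hB
  have hsurj : Function.Surjective L := fun Z => ⟨B * Z, by
    rw [hL, ← Matrix.mul_assoc, hB', Matrix.one_mul]⟩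
  have h := LinearMap.finrank_range_add_finrank_ker L
  rw [LinearMap.range_eq_top.2 hsurj, finrank_top, finrank_matrix, finrank_matrix] at h
  simp only [Fintype.card_fin, finrank_self, mul_one] at h
  rw [Nat.mul_sub, mul_comm r n]
  omega

/-- The chart A ↦ A(B₀ᵀA)⁻¹ - B₀ keeps the column span of A in A(B₀ᵀA)⁻¹ and takes values in the
kernel of B₀ᵀ, of dimension only r(n-r). A net of that kernel is turned back into orthonormal
frames. -/
theorem exists_local_stiefel_net {n r : ℕ} (hrn : r ≤ n) {ε : ℝ} (hε : 0 < ε)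
    {B₀ : Matrix (Fin n) (Fin r) ℝ} (hB₀ : B₀ ∈ stiefel n r) :
    ∃ t : Finset (Matrix (Fin n) (Fin r) ℝ), (∀ B ∈ t, B ∈ stiefel n r) ∧
      (t.card : ℝ) ≤ (1 + 8 / ε) ^ (r * (n - r)) ∧
      ∀ A ∈ stiefel n r, ‖A - B₀‖ ≤ 1 / 2 → ∃ B ∈ t, ‖A - B * (Bᵀ * A)‖ ≤ ε := by
  classical
  let L : Matrix (Fin n) (Fin r) ℝ →ₗ[ℝ] Matrix (Fin r) (Fin r) ℝ :=
    { toFun := fun X => B₀ᵀ * X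
      map_add' := fun X Y => Matrix.mul_add _ _ _
      map_smul' := fun c X => Matrix.mul_smul _ _ _ }
  have hL : ∀ X, L X = B₀ᵀ * X := fun _ => rfl
  -- The chart takes values in the ball of radius 2 (`hXn`); at scale ε/2 the volumetric base is 1 +
  -- 8/ε.
  obtain ⟨u, -, hucard, hu⟩ := exists_finset_net_of_norm_le (E := LinearMap.ker L)
    (R := 2) (ε := ε / 2) (by norm_num) (by positivity) {X | ‖X‖ ≤ 2} (fun c hc => hc)
  rw [finrank_ker_transpose_mul hB₀ L hL] at hucard
  choose W hW hWM using fun M : Matrix (Fin n) (Fin r) ℝ => exists_stiefel_mul_transpose_mul hrn M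
  refine ⟨u.image fun Y => W (B₀ + Y.1), ?_, ?_, ?_⟩
  · intro B hB
    obtain ⟨Y, -, rfl⟩ := Finset.mem_image.1 hB
    exact hW _
  · refine le_trans (by exact_mod_cast Finset.card_image_le) (hucard.trans_eq ?_)
    congr 2
    field_simp
    norm_num
  · intro A hA hAB
    have hBn := norm_le_one_of_mem_stiefel hB₀
    have hAn := norm_le_one_of_mem_stiefel hA
    have hBtn : ‖B₀ᵀ‖ ≤ 1 := by rwa [Matrix.l2_opNorm_transpose]
    have hB' : B₀ᵀ * B₀ = 1 := hB₀
    set H := B₀ᵀ * A with hH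
    have hHn : ‖H‖ ≤ 1 := (Matrix.l2_opNorm_mul _ _).trans
      (mul_le_one₀ hBtn (norm_nonneg _) hAn)
    have hH1 : ‖1 - H‖ ≤ 1 / 2 := by
      have : 1 - H = B₀ᵀ * (B₀ - A) := by rw [Matrix.mul_sub, hB']
      rw [this]
      refine (Matrix.l2_opNorm_mul _ _).trans ?_
      rw [norm_sub_rev] at hAB
      nlinarith [norm_nonneg (B₀ - A), norm_nonneg B₀ᵀ]
    have hunit : IsUnit H := by
      have := isUnit_one_sub_of_norm_lt_one (x := 1 - H) (by linarith)
      rwa [sub_sub_cancel] at this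
    obtain ⟨G, hHG, hGH⟩ := isUnit_iff_exists.1 hunit
    have hGn : ‖G‖ ≤ 2 := by
      -- Self-bounding: ‖G‖ ≤ 1 + ‖G‖/2.
      have e : G = 1 + (1 - H) * G := by rw [sub_mul, hHG, one_mul]; abel
      have h1 : ‖G‖ ≤ ‖(1 : Matrix (Fin r) (Fin r) ℝ)‖ + ‖(1 - H) * G‖ := by
        conv_lhs => rw [e]
        exact norm_add_le _ _
      have h2 := Matrix.l2_opNorm_mul (1 - H) G
      have h3 := Matrix.l2_opNorm_one_le (m := Fin r)
      nlinarith [norm_nonneg G]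
    have hXn : ‖A * G - B₀‖ ≤ 2 := by
      have e : A * G - B₀ = ((A - B₀) + B₀ * (B₀ᵀ * (B₀ - A))) * G := by
        rw [Matrix.mul_sub, hB', Matrix.mul_sub, ← hH, Matrix.mul_one, sub_add_sub_cancel,
          Matrix.sub_mul, Matrix.mul_assoc, hHG, Matrix.mul_one]
      have h0 : ‖B₀ᵀ * (B₀ - A)‖ ≤ 1 / 2 := by rwa [Matrix.mul_sub, hB']
      have h1 : ‖B₀ * (B₀ᵀ * (B₀ - A))‖ ≤ 1 / 2 := by
        refine (Matrix.l2_opNorm_mul _ _).trans ?_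
        nlinarith [norm_nonneg (B₀ᵀ * (B₀ - A)), norm_nonneg B₀]
      have h2 := norm_add_le (A - B₀) (B₀ * (B₀ᵀ * (B₀ - A)))
      rw [e]
      refine (Matrix.l2_opNorm_mul _ _).trans ?_
      nlinarith [norm_nonneg G, norm_nonneg ((A - B₀) + B₀ * (B₀ᵀ * (B₀ - A)))]
    have hXker : A * G - B₀ ∈ LinearMap.ker L := by
      rw [LinearMap.mem_ker, hL, Matrix.mul_sub, ← Matrix.mul_assoc, ← hH, hHG, hB', sub_self]
    obtain ⟨Y, hYu, hY⟩ := hu ⟨A * G - B₀, hXker⟩ hXn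
    refine ⟨W (B₀ + Y.1), Finset.mem_image_of_mem _ hYu, ?_⟩
    set B := W (B₀ + Y.1) with hBdef
    have hBB : B * (Bᵀ * (B₀ + Y.1)) = B₀ + Y.1 := hWM _
    have hY' : ‖A * G - B₀ - Y.1‖ ≤ ε / 2 := hY
    set Z := (A * G - B₀ - Y.1) * H with hZ
    have hZn : ‖Z‖ ≤ ε / 2 := by
      refine (Matrix.l2_opNorm_mul _ _).trans ?_
      nlinarith [norm_nonneg H, norm_nonneg (A * G - B₀ - Y.1)]
    have hAdec : A = (B₀ + Y.1) * H + Z := by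
      rw [hZ, ← Matrix.add_mul, show B₀ + Y.1 + (A * G - B₀ - Y.1) = A * G by abel,
        Matrix.mul_assoc, hGH, Matrix.mul_one]
    -- The projection B Bᵀ fixes (B₀ + Y)H, so only Z contributes to the residual.
    have hres : A - B * (Bᵀ * A) = Z - B * (Bᵀ * Z) := by
      have h1 : B * (Bᵀ * A) = (B₀ + Y.1) * H + B * (Bᵀ * Z) := by
        conv_lhs => rw [hAdec]
        rw [Matrix.mul_add, Matrix.mul_add, ← Matrix.mul_assoc Bᵀ, ← Matrix.mul_assoc B, hBB]
      rw [h1]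
      nth_rewrite 1 [hAdec]
      abel
    have hBn' := norm_le_one_of_mem_stiefel (hW (B₀ + Y.1))
    rw [← hBdef] at hBn'
    have h1 : ‖B * (Bᵀ * Z)‖ ≤ ε / 2 := by
      have hBt : ‖Bᵀ‖ ≤ 1 := by rwa [Matrix.l2_opNorm_transpose]
      have h2 := Matrix.l2_opNorm_mul Bᵀ Z
      have h3 := Matrix.l2_opNorm_mul B (Bᵀ * Z)
      have h4 : ‖Bᵀ‖ * ‖Z‖ ≤ ‖Z‖ := mul_le_of_le_one_left (norm_nonneg _) hBt
      have h5 : ‖B‖ * ‖Bᵀ * Z‖ ≤ ‖Bᵀ * Z‖ := mul_le_of_le_one_left (norm_nonneg _) hBn'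
      linarith
    rw [hres]
    linarith [norm_sub_le Z (B * (Bᵀ * Z))]

theorem exists_stiefel_net {n r : ℕ} (hrn : r ≤ n) {ε : ℝ} (hε : 0 < ε) (hε1 : ε ≤ 1) :
    ∃ t : Finset (Matrix (Fin n) (Fin r) ℝ), (∀ B ∈ t, B ∈ stiefel n r) ∧
      (t.card : ℝ) ≤ (5625 / ε) ^ (r * (n - r) + r.choose 2) ∧
      ∀ A ∈ stiefel n r, ∃ B ∈ t, ‖A - B * (Bᵀ * A)‖ ≤ ε := by
  classical
  have hbase : 1 ≤ 5625 / ε := by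
    rw [one_le_div hε]
    linarith
  rcases Nat.eq_zero_or_pos r with rfl | hr
  · refine ⟨{0}, ?_, ?_, fun A _ => ⟨0, by simp, ?_⟩⟩
    · intro B _
      change Bᵀ * B = 1
      ext i
      exact i.elim0
    · simp
    · refine le_of_eq_of_le (norm_eq_zero.2 ?_) hε.le
      ext i j
      exact j.elim0
  -- For r = n the identity already spans everything; the inequality nr ≤ 4k used below would fail
  -- at n = r = 1.
  rcases hrn.eq_or_lt with rfl | hlt
  · refine ⟨{1}, ?_, ?_, fun A _ => ⟨1, by simp, ?_⟩⟩
    · intro B hB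
      rw [Finset.mem_singleton.1 hB]
      change (1 : Matrix (Fin r) (Fin r) ℝ)ᵀ * 1 = 1
      simp
    · simpa using one_le_pow₀ hbase
    · simpa using hε.le
  obtain ⟨u, hus, hucard, hu⟩ := exists_finset_net_of_norm_le (R := 1) (ε := 1 / 2) zero_le_one
    (by norm_num) (stiefel n r) (fun c hc => norm_le_one_of_mem_stiefel hc)
  choose! t hts htcard ht using fun (B₀ : Matrix (Fin n) (Fin r) ℝ) (hB₀ : B₀ ∈ stiefel n r) =>
    exists_local_stiefel_net hrn hε hB₀
  refine ⟨u.biUnion t, ?_, ?_, ?_⟩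
  · intro B hB
    obtain ⟨B₀, hB₀, hB⟩ := Finset.mem_biUnion.1 hB
    exact hts B₀ (hus hB₀) B hB
  · set k := r * (n - r) + r.choose 2 with hk
    -- The coarse net lives in the full nr-dimensional matrix space. Its cost 5^(nr) does not
    -- involve ε, so it enters only the constant: 5625 = 5^4 · 9.
    have hnr : n * r ≤ 4 * k := by
      have h1 : (r.choose 2 : ℝ) = r * (r - 1) / 2 := Nat.cast_choose_two ℝ r
      have h2 : (n : ℝ) * r ≤ 4 * k := by
        rw [hk]
        push_cast [Nat.cast_sub hrn]
        rw [h1]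
        have h3 : (r : ℝ) + 1 ≤ n := by exact_mod_cast hlt
        have h4 : (1 : ℝ) ≤ r := by exact_mod_cast hr
        nlinarith
      exact_mod_cast h2
    have hfin : finrank ℝ (Matrix (Fin n) (Fin r) ℝ) = n * r := by
      rw [finrank_matrix]
      simp
    have hu5 : (u.card : ℝ) ≤ 625 ^ k := by
      rw [hfin] at hucard
      calc (u.card : ℝ) ≤ 5 ^ (n * r) := by
            refine hucard.trans_eq ?_
            norm_num
        _ ≤ 5 ^ (4 * k) := pow_le_pow_right₀ (by norm_num) hnr
        _ = 625 ^ k := by rw [pow_mul]; norm_num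
    have h8 : 1 + 8 / ε ≤ 9 / ε := by
      rw [show 9 / ε = 1 / ε + 8 / ε by ring]
      have : 1 ≤ 1 / ε := by rwa [one_le_div hε]
      linarith
    have h9 : 1 ≤ 9 / ε := by
      rw [one_le_div hε]
      linarith
    calc ((u.biUnion t).card : ℝ) ≤ ∑ B ∈ u, ((t B).card : ℝ) := by
          exact_mod_cast Finset.card_biUnion_le
      _ ≤ ∑ B ∈ u, (9 / ε) ^ k := by
          refine Finset.sum_le_sum fun B hB => (htcard B (hus hB)).trans ?_
          calc (1 + 8 / ε) ^ (r * (n - r)) ≤ (9 / ε) ^ (r * (n - r)) :=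
                pow_le_pow_left₀ (by positivity) h8 _
            _ ≤ (9 / ε) ^ k := pow_le_pow_right₀ h9 (by omega)
      _ = u.card * (9 / ε) ^ k := by rw [Finset.sum_const, nsmul_eq_mul]
      _ ≤ 625 ^ k * (9 / ε) ^ k := by gcongr
      _ = (5625 / ε) ^ k := by
          rw [← mul_pow]
          congr 1
          ring
  · intro A hA
    obtain ⟨B₀, hB₀, hAB⟩ := hu A hA
    obtain ⟨B, hB, h⟩ := ht B₀ (hus hB₀) A hA hAB
    exact ⟨B, Finset.mem_biUnion.2 ⟨B₀, hB₀, hB⟩, h⟩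

end GrassmannNets

/-! ### Stability of contractions and reduction to the net -/

section Contractions

open scoped Matrix.Norms.L2Operator

theorem frobNorm_eq_norm {d : ℕ} {n : Fin d → ℕ} (T : Tensor n) :
    frobNorm T = ‖WithLp.toLp 2 T‖ := by
  rw [frobNorm, tensorInner, EuclideanSpace.norm_eq]
  simp [sq]

theorem frobNorm_nonneg {d : ℕ} {n : Fin d → ℕ} (T : Tensor n) : 0 ≤ frobNorm T :=
  Real.sqrt_nonneg _

theorem frobNorm_sq {d : ℕ} {n : Fin d → ℕ} (T : Tensor n) : frobNorm T ^ 2 = ∑ i, T i ^ 2 := by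
  rw [frobNorm, tensorInner, Real.sq_sqrt (Finset.sum_nonneg fun i _ => mul_self_nonneg _)]
  simp [sq]

theorem frobNorm_add_le {d : ℕ} {n : Fin d → ℕ} (S T : Tensor n) :
    frobNorm (S + T) ≤ frobNorm S + frobNorm T := by
  simp only [frobNorm_eq_norm, WithLp.toLp_add]
  exact norm_add_le _ _

theorem prod_update_apply {d : ℕ} {n p : Fin d → ℕ}
    (A : (l : Fin d) → Matrix (Fin (n l)) (Fin (p l)) ℝ) (l : Fin d)
    (X : Matrix (Fin (n l)) (Fin (p l)) ℝ) (i : (l : Fin d) → Fin (n l))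
    (j : (l : Fin d) → Fin (p l)) :
    ∏ l', Function.update A l X l' (i l') (j l') =
      X (i l) (j l) * ∏ l' ∈ Finset.univ.erase l, A l' (i l') (j l') := by
  rw [← Finset.mul_prod_erase _ _ (Finset.mem_univ l), Function.update_self]
  congr 1
  refine Finset.prod_congr rfl fun l' hl' => ?_
  rw [Function.update_of_ne (Finset.ne_of_mem_erase hl')]

theorem contraction_update_add {d : ℕ} {n p : Fin d → ℕ} (T : Tensor n)
    (A : (l : Fin d) → Matrix (Fin (n l)) (Fin (p l)) ℝ) (l : Fin d)
    (X Y : Matrix (Fin (n l)) (Fin (p l)) ℝ) :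
    contraction T (Function.update A l (X + Y)) =
      contraction T (Function.update A l X) + contraction T (Function.update A l Y) := by
  funext j
  simp only [contraction, Pi.add_apply, prod_update_apply, Matrix.add_apply, add_mul, mul_add,
    Finset.sum_add_distrib]

theorem contraction_update_mul {d : ℕ} {n p : Fin d → ℕ} (T : Tensor n)
    (A : (l : Fin d) → Matrix (Fin (n l)) (Fin (p l)) ℝ) (l : Fin d)
    (B : Matrix (Fin (n l)) (Fin (p l)) ℝ) (H : Matrix (Fin (p l)) (Fin (p l)) ℝ)
    (j : (l : Fin d) → Fin (p l)) :
    contraction T (Function.update A l (B * H)) j =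
      ∑ k, contraction T (Function.update A l B) (Function.update j l k) * H k (j l) := by
  simp only [contraction, Finset.sum_mul]
  rw [Finset.sum_comm]
  refine Finset.sum_congr rfl fun i _ => ?_
  simp only [prod_update_apply, Function.update_self, Matrix.mul_apply, Finset.sum_mul,
    Finset.mul_sum]
  refine Finset.sum_congr rfl fun k _ => ?_
  have : ∏ l' ∈ Finset.univ.erase l, A l' (i l') (Function.update j l k l') =
      ∏ l' ∈ Finset.univ.erase l, A l' (i l') (j l') :=
    Finset.prod_congr rfl fun l' hl' => by
      rw [Function.update_of_ne (Finset.ne_of_mem_erase hl')]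
  rw [this]
  ring

theorem Matrix.sum_sq_vecMul_le {m k : Type*} [Fintype m] [Fintype k] [DecidableEq m]
    [DecidableEq k] (H : Matrix k m ℝ) (v : k → ℝ) :
    ∑ j, (∑ i, v i * H i j) ^ 2 ≤ ‖H‖ ^ 2 * ∑ i, v i ^ 2 := by
  have h := Matrix.l2_opNorm_mulVec Hᵀ (WithLp.toLp 2 v)
  rw [Matrix.l2_opNorm_transpose] at h
  have h2 := pow_le_pow_left₀ (norm_nonneg _) h 2
  rw [mul_pow, EuclideanSpace.norm_sq_eq, EuclideanSpace.norm_sq_eq] at h2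
  simpa [Matrix.mulVec, dotProduct, mul_comm] using h2

/-- Right multiplication by `H` acts separately on each mode-`l` fibre, so splitting `j l` from the
other indices reduces the claim to a vector estimate. -/
theorem frobNorm_contraction_update_mul_le {d : ℕ} {n p : Fin d → ℕ} (T : Tensor n)
    (A : (l : Fin d) → Matrix (Fin (n l)) (Fin (p l)) ℝ) (l : Fin d)
    (B : Matrix (Fin (n l)) (Fin (p l)) ℝ) (H : Matrix (Fin (p l)) (Fin (p l)) ℝ) :
    frobNorm (contraction T (Function.update A l (B * H))) ≤
      ‖H‖ * frobNorm (contraction T (Function.update A l B)) := by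
  rw [← sq_le_sq₀ (frobNorm_nonneg _) (mul_nonneg (norm_nonneg _) (frobNorm_nonneg _)), mul_pow,
    frobNorm_sq, frobNorm_sq]
  simp only [contraction_update_mul]
  set F := contraction T (Function.update A l B)
  let e := Equiv.piSplitAt l fun l' => Fin (p l')
  have hupd : ∀ (m k : Fin (p l)) (q : (l' : { l' // l' ≠ l }) → Fin (p l')),
      Function.update (e.symm (m, q)) l k = e.symm (k, q) := by
    intro m k q
    funext l'
    by_cases h : l' = l
    · subst h
      simp [e]
    · rw [Function.update_of_ne h]
      simp [e, h]
  have hself : ∀ (m : Fin (p l)) (q : (l' : { l' // l' ≠ l }) → Fin (p l')),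
      e.symm (m, q) l = m := by
    intro m q
    simp [e]
  rw [← e.symm.sum_comp, ← e.symm.sum_comp, Fintype.sum_prod_type_right,
    Fintype.sum_prod_type_right, Finset.mul_sum]
  refine Finset.sum_le_sum fun q _ => ?_
  simp only [hupd, hself]
  exact Matrix.sum_sq_vecMul_le H fun k => F (e.symm (k, q))

theorem abs_apply_le_one_of_mem_stiefel {n r : ℕ} {A : Matrix (Fin n) (Fin r) ℝ}
    (hA : A ∈ stiefel n r) (i : Fin n) (j : Fin r) : |A i j| ≤ 1 := by
  have h : (Aᵀ * A) j j = 1 := by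
    rw [show Aᵀ * A = 1 from hA, Matrix.one_apply_eq]
  rw [Matrix.mul_apply] at h
  have h1 := Finset.single_le_sum (f := fun k => Aᵀ j k * A k j)
    (fun k _ => mul_self_nonneg (A k j)) (Finset.mem_univ i)
  rw [h] at h1
  exact abs_le_one_iff_mul_self_le_one.2 h1

/-- A crude bound, needed only to make the real supremum below genuine. -/
theorem exists_frobNorm_contraction_le {d : ℕ} {n r : Fin d → ℕ} (T : Tensor n) :
    ∃ K : ℝ, ∀ A : (l : Fin d) → Matrix (Fin (n l)) (Fin (r l)) ℝ,
      (∀ l, A l ∈ stiefel (n l) (r l)) → frobNorm (contraction T A) ≤ K := by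
  refine ⟨Real.sqrt (∑ _j : (l : Fin d) → Fin (r l), (∑ i, |T i|) ^ 2), fun A hA => ?_⟩
  refine Real.le_sqrt_of_sq_le ?_
  rw [frobNorm_sq]
  refine Finset.sum_le_sum fun j _ => ?_
  rw [← sq_abs]
  refine pow_le_pow_left₀ (abs_nonneg _) ((Finset.abs_sum_le_sum_abs _ _).trans ?_) 2
  refine Finset.sum_le_sum fun i _ => ?_
  rw [abs_mul, Finset.abs_prod]
  exact mul_le_of_le_one_right (abs_nonneg _) (Finset.prod_le_one (fun _ _ => abs_nonneg _)
    fun l _ => abs_apply_le_one_of_mem_stiefel (hA l) _ _)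

/-- Factors are moved to the net one at a time. `M` bounds all orthonormal tuples, so it applies to
the mixed tuples that occur on the way. -/
theorem frobNorm_contraction_le_of_nets {d : ℕ} {n r : Fin d → ℕ} (hrn : ∀ l, r l ≤ n l)
    {ε : ℝ} (hε : 0 ≤ ε) (t : (l : Fin d) → Finset (Matrix (Fin (n l)) (Fin (r l)) ℝ))
    (hts : ∀ l, ∀ B ∈ t l, B ∈ stiefel (n l) (r l))
    (ht : ∀ l, ∀ A ∈ stiefel (n l) (r l), ∃ B ∈ t l, ‖A - B * (Bᵀ * A)‖ ≤ ε)
    (T : Tensor n) {M : ℝ} (hM : ∀ A : (l : Fin d) → Matrix (Fin (n l)) (Fin (r l)) ℝ,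
      (∀ l, A l ∈ stiefel (n l) (r l)) → frobNorm (contraction T A) ≤ M)
    (A : (l : Fin d) → Matrix (Fin (n l)) (Fin (r l)) ℝ)
    (hA : ∀ l, A l ∈ stiefel (n l) (r l)) (s : Finset (Fin d)) :
    ∃ B : (l : Fin d) → Matrix (Fin (n l)) (Fin (r l)) ℝ,
      (∀ l, B l ∈ stiefel (n l) (r l)) ∧ (∀ l ∈ s, B l ∈ t l) ∧
      frobNorm (contraction T A) ≤ frobNorm (contraction T B) + s.card * (ε * M) := by
  classical
  induction s using Finset.induction_on with
  | empty => exact ⟨A, hA, by simp, by simp⟩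
  | insert l s hl ih =>
    obtain ⟨B, hB, hBt, hle⟩ := ih
    obtain ⟨X, hXt, hX⟩ := ht l (B l) (hB l)
    have hXs := hts l X hXt
    have hupd : ∀ Y ∈ stiefel (n l) (r l), ∀ l', Function.update B l Y l' ∈
        stiefel (n l') (r l') := by
      intro Y hY l'
      by_cases h : l' = l
      · subst h
        rwa [Function.update_self]
      · rw [Function.update_of_ne h]
        exact hB l'
    have htn : ∀ Y ∈ stiefel (n l) (r l), ‖Yᵀ‖ ≤ 1 := fun Y hY => by
      rw [Matrix.l2_opNorm_transpose]
      exact norm_le_one_of_mem_stiefel hY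
    refine ⟨Function.update B l X, hupd X hXs, ?_, ?_⟩
    · intro l' hl'
      rcases Finset.mem_insert.1 hl' with rfl | h
      · rwa [Function.update_self]
      · rw [Function.update_of_ne (fun e : l' = l => hl (e ▸ h))]
        exact hBt l' h
    · have h1 : contraction T B = contraction T (Function.update B l (X * (Xᵀ * B l))) +
          contraction T (Function.update B l (B l - X * (Xᵀ * B l))) := by
        rw [← contraction_update_add, add_sub_cancel, Function.update_eq_self]
      have h2 : frobNorm (contraction T (Function.update B l (X * (Xᵀ * B l)))) ≤
          frobNorm (contraction T (Function.update B l X)) := by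
        refine (frobNorm_contraction_update_mul_le _ _ _ _ _).trans
          (mul_le_of_le_one_left (frobNorm_nonneg _) ((Matrix.l2_opNorm_mul _ _).trans ?_))
        exact mul_le_one₀ (htn X hXs) (norm_nonneg _) (norm_le_one_of_mem_stiefel (hB l))
      have h3 : frobNorm (contraction T (Function.update B l (B l - X * (Xᵀ * B l)))) ≤ ε * M := by
        -- The residual E is not orthonormal; writing E = W(WᵀE) with ‖WᵀE‖ ≤ ε lets `hM` apply to
        -- the tuple containing W.
        obtain ⟨W, hW, hWE⟩ := exists_stiefel_mul_transpose_mul (hrn l) (B l - X * (Xᵀ * B l))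
        rw [← hWE]
        refine (frobNorm_contraction_update_mul_le _ _ _ _ _).trans
          (mul_le_mul ((Matrix.l2_opNorm_mul _ _).trans ?_) (hM _ (hupd W hW)) (frobNorm_nonneg _)
            hε)
        exact (mul_le_of_le_one_left (norm_nonneg _) (htn W hW)).trans hX
      have h4 := frobNorm_add_le (contraction T (Function.update B l (X * (Xᵀ * B l))))
        (contraction T (Function.update B l (B l - X * (Xᵀ * B l))))
      rw [← h1] at h4
      rw [Finset.card_insert_of_notMem hl]
      push_cast
      linarith

theorem frobNorm_contraction_le_two_mul {d : ℕ} (hd : 1 ≤ d) {n r : Fin d → ℕ}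
    (hrn : ∀ l, r l ≤ n l) (t : (l : Fin d) → Finset (Matrix (Fin (n l)) (Fin (r l)) ℝ))
    (hts : ∀ l, ∀ B ∈ t l, B ∈ stiefel (n l) (r l))
    (ht : ∀ l, ∀ A ∈ stiefel (n l) (r l), ∃ B ∈ t l, ‖A - B * (Bᵀ * A)‖ ≤ 1 / (2 * d))
    (T : Tensor n) {m : ℝ} (hm : ∀ B : (l : Fin d) → Matrix (Fin (n l)) (Fin (r l)) ℝ,
      (∀ l, B l ∈ t l) → frobNorm (contraction T B) ≤ m)
    (A : (l : Fin d) → Matrix (Fin (n l)) (Fin (r l)) ℝ)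
    (hA : ∀ l, A l ∈ stiefel (n l) (r l)) : frobNorm (contraction T A) ≤ 2 * m := by
  have hd' : (0 : ℝ) < d := by exact_mod_cast hd
  let S : Set ℝ := {x | ∃ A : (l : Fin d) → Matrix (Fin (n l)) (Fin (r l)) ℝ,
    (∀ l, A l ∈ stiefel (n l) (r l)) ∧ frobNorm (contraction T A) = x}
  have hbdd : BddAbove S := by
    obtain ⟨K, hK⟩ := exists_frobNorm_contraction_le (r := r) T
    exact ⟨K, by rintro x ⟨A, hA, rfl⟩; exact hK A hA⟩
  have hM : ∀ A : (l : Fin d) → Matrix (Fin (n l)) (Fin (r l)) ℝ,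
      (∀ l, A l ∈ stiefel (n l) (r l)) → frobNorm (contraction T A) ≤ sSup S :=
    fun A hA => le_csSup hbdd ⟨A, hA, rfl⟩
  -- The d replacements cost d · (1/(2d)) = 1/2 of the supremum, which is finite and can be
  -- absorbed.
  have hS : sSup S ≤ m + 1 / 2 * sSup S := by
    refine csSup_le ⟨_, A, hA, rfl⟩ ?_
    rintro x ⟨A', hA', rfl⟩
    obtain ⟨B, -, hBt, hle⟩ := frobNorm_contraction_le_of_nets hrn (by positivity) t hts ht T hM
      A' hA' Finset.univ
    have h1 := hm B fun l => hBt l (Finset.mem_univ l)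
    rw [Finset.card_univ, Fintype.card_fin] at hle
    have h2 : (d : ℝ) * (1 / (2 * d) * sSup S) = 1 / 2 * sSup S := by field_simp
    linarith
  linarith [hM A hA]

end Contractions

/-! ### Gaussian exponential moments and tails -/

section GaussianMoments

theorem lintegral_ofReal_fintype_prod {ι : Type*} [Fintype ι] (μ : Measure ℝ)
    [IsProbabilityMeasure μ] (f : ι → ℝ → ℝ) (hf : ∀ i x, 0 ≤ f i x)
    (hint : ∀ i, Integrable (f i) μ) :
    ∫⁻ x, ENNReal.ofReal (∏ i, f i (x i)) ∂(Measure.pi fun _ : ι => μ) =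
      ENNReal.ofReal (∏ i, ∫ x, f i x ∂μ) := by
  rw [← integral_fintype_prod_eq_prod, ofReal_integral_eq_lintegral_ofReal]
  · exact Integrable.fintype_prod hint
  · exact Filter.Eventually.of_forall fun x => Finset.prod_nonneg fun i _ => hf i _

theorem integral_exp_mul_gaussianReal (a : ℝ) :
    ∫ x, Real.exp (a * x) ∂(gaussianReal 0 1) = Real.exp (a ^ 2 / 2) := by
  have h := congrFun (mgf_id_gaussianReal (μ := 0) (v := 1)) a
  simpa [mgf] using h

theorem lintegral_exp_sum_mul_gaussianReal {ι : Type*} [Fintype ι] (a : ι → ℝ) :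
    ∫⁻ x, ENNReal.ofReal (Real.exp (∑ i, a i * x i)) ∂(Measure.pi fun _ : ι => gaussianReal 0 1) =
      ENNReal.ofReal (Real.exp ((∑ i, a i ^ 2) / 2)) := by
  have h := lintegral_ofReal_fintype_prod (gaussianReal 0 1) (fun i x => Real.exp (a i * x))
    (fun i x => (Real.exp_pos _).le) (fun i => integrable_exp_mul_gaussianReal (a i))
  simpa only [integral_exp_mul_gaussianReal, ← Real.exp_sum, ← Finset.sum_div] using h

theorem integral_exp_sq_div_four_gaussianReal :
    ∫ x, Real.exp (x ^ 2 / 4) ∂(gaussianReal 0 1) = √2 := by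
  rw [integral_gaussianReal_eq_integral_smul one_ne_zero]
  have e : ∀ x : ℝ, gaussianPDFReal 0 1 x • Real.exp (x ^ 2 / 4) =
      (√(2 * Real.pi))⁻¹ * Real.exp (-(1 / 4) * x ^ 2) := by
    intro x
    rw [gaussianPDFReal_def, smul_eq_mul, mul_assoc, ← Real.exp_add]
    simp only [NNReal.coe_one, mul_one, sub_zero]
    congr 2
    ring
  simp_rw [e]
  rw [integral_const_mul, integral_gaussian, ← Real.sqrt_inv, ← Real.sqrt_mul (by positivity)]
  congr 1
  field_simp
  norm_num

theorem lintegral_exp_sum_sq_div_four_gaussianReal (ι : Type*) [Fintype ι] :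
    ∫⁻ x, ENNReal.ofReal (Real.exp ((∑ i, x i ^ 2) / 4))
      ∂(Measure.pi fun _ : ι => gaussianReal 0 1) = ENNReal.ofReal (√2 ^ Fintype.card ι) := by
  have hint : Integrable (fun x : ℝ => Real.exp (x ^ 2 / 4)) (gaussianReal 0 1) := by
    -- A non-integrable function would have Bochner integral 0, not √2.
    by_contra h
    have h1 := integral_undef h
    rw [integral_exp_sq_div_four_gaussianReal] at h1
    exact absurd h1 (by positivity)
  have h := lintegral_ofReal_fintype_prod (ι := ι) (gaussianReal 0 1)
    (fun _ x => Real.exp (x ^ 2 / 4)) (fun i x => (Real.exp_pos _).le) (fun _ => hint)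
  simpa only [integral_exp_sq_div_four_gaussianReal, ← Real.exp_sum, ← Finset.sum_div,
    Finset.prod_const, Finset.card_univ] using h

theorem sum_sq_sum_mul_prod_stiefel {d : ℕ} {n r : Fin d → ℕ}
    {W : (l : Fin d) → Matrix (Fin (n l)) (Fin (r l)) ℝ}
    (hW : ∀ l, W l ∈ stiefel (n l) (r l)) (g : Tensor r) :
    ∑ i : (l : Fin d) → Fin (n l), (∑ j, g j * ∏ l, W l (i l) (j l)) ^ 2 = ∑ j, g j ^ 2 := by
  have horth : ∀ j j' : (l : Fin d) → Fin (r l),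
      ∑ i : (l : Fin d) → Fin (n l), (∏ l, W l (i l) (j l)) * (∏ l, W l (i l) (j' l)) =
        if j = j' then 1 else 0 := by
    intro j j'
    simp only [← Finset.prod_mul_distrib]
    have h := Finset.prod_univ_sum (fun l : Fin d => (Finset.univ : Finset (Fin (n l))))
      (fun l k => W l k (j l) * W l k (j' l))
    rw [Fintype.piFinset_univ] at h
    rw [← h]
    have h2 : ∀ l, ∑ k, W l k (j l) * W l k (j' l) = if j l = j' l then 1 else 0 := by
      intro l
      have h3 : ((W l)ᵀ * W l) (j l) (j' l) = (1 : Matrix (Fin (r l)) (Fin (r l)) ℝ) (j l) (j' l) :=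
        by rw [show (W l)ᵀ * W l = 1 from hW l]
      rwa [Matrix.mul_apply, Matrix.one_apply] at h3
    simp only [h2]
    rw [Finset.prod_ite_zero]
    simp [funext_iff]
  calc ∑ i : (l : Fin d) → Fin (n l), (∑ j, g j * ∏ l, W l (i l) (j l)) ^ 2
      = ∑ i : (l : Fin d) → Fin (n l), ∑ j, ∑ j', g j * g j' *
          ((∏ l, W l (i l) (j l)) * (∏ l, W l (i l) (j' l))) := by
        refine Finset.sum_congr rfl fun i _ => ?_
        rw [sq, Finset.sum_mul_sum]
        refine Finset.sum_congr rfl fun j _ => Finset.sum_congr rfl fun j' _ => ?_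
        ring
    _ = ∑ j, ∑ j', g j * g j' * ∑ i : (l : Fin d) → Fin (n l),
          ((∏ l, W l (i l) (j l)) * (∏ l, W l (i l) (j' l))) := by
        rw [Finset.sum_comm]
        refine Finset.sum_congr rfl fun j _ => ?_
        rw [Finset.sum_comm]
        refine Finset.sum_congr rfl fun j' _ => ?_
        rw [Finset.mul_sum]
    _ = ∑ j, g j ^ 2 := by
        simp only [horth]
        refine Finset.sum_congr rfl fun j _ => ?_
        simp [sq]

/-- Linearisation by an independent Gaussian g: exp(|y|²/4) = E exp(⟨y, g⟩/√2). After Tonelli, the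
integral over T sees g contracted with the transposes of W, which has the same norm as g. The law of
the contraction is never needed. -/
theorem lintegral_exp_frobNorm_contraction {d : ℕ} {n r : Fin d → ℕ}
    {W : (l : Fin d) → Matrix (Fin (n l)) (Fin (r l)) ℝ}
    (hW : ∀ l, W l ∈ stiefel (n l) (r l)) :
    ∫⁻ T : Tensor n, ENNReal.ofReal (Real.exp (frobNorm (contraction T W) ^ 2 / 4))
      ∂(Measure.pi fun _ => gaussianReal 0 1) = ENNReal.ofReal (√2 ^ ∏ l, r l) := by
  have hc : (√2)⁻¹ ^ 2 = (1 / 2 : ℝ) := by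
    rw [inv_pow, Real.sq_sqrt (by norm_num)]
    norm_num
  set c : ℝ := (√2)⁻¹
  have h1 : ∀ T : Tensor n, ENNReal.ofReal (Real.exp (frobNorm (contraction T W) ^ 2 / 4)) =
      ∫⁻ g : Tensor r, ENNReal.ofReal (Real.exp (∑ j, c * contraction T W j * g j))
        ∂(Measure.pi fun _ => gaussianReal 0 1) := by
    intro T
    rw [lintegral_exp_sum_mul_gaussianReal, frobNorm_sq]
    simp only [mul_pow, hc, ← Finset.mul_sum]
    congr 2
    ring
  have h2 : ∀ (T : Tensor n) (g : Tensor r), ∑ j, c * contraction T W j * g j =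
      ∑ i, (c * ∑ j, g j * ∏ l, W l (i l) (j l)) * T i := by
    intro T g
    simp only [contraction, Finset.mul_sum, Finset.sum_mul]
    rw [Finset.sum_comm]
    refine Finset.sum_congr rfl fun i _ => Finset.sum_congr rfl fun j _ => ?_
    ring
  simp only [h1]
  rw [lintegral_lintegral_swap]
  · simp only [h2, lintegral_exp_sum_mul_gaussianReal, mul_pow, hc, ← Finset.mul_sum,
      sum_sq_sum_mul_prod_stiefel hW]
    have h3 := lintegral_exp_sum_sq_div_four_gaussianReal ((l : Fin d) → Fin (r l))
    rw [Fintype.card_pi] at h3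
    simp only [Fintype.card_fin] at h3
    rw [← h3]
    refine lintegral_congr fun g => ?_
    congr 2
    ring
  · refine Measurable.aemeasurable ?_
    unfold Function.uncurry contraction
    fun_prop

theorem measure_lt_frobNorm_contraction_sq_le {d : ℕ} {n r : Fin d → ℕ}
    {W : (l : Fin d) → Matrix (Fin (n l)) (Fin (r l)) ℝ}
    (hW : ∀ l, W l ∈ stiefel (n l) (r l)) (u : ℝ) :
    (Measure.pi fun _ => gaussianReal 0 1) {T : Tensor n | u < frobNorm (contraction T W) ^ 2} ≤
      ENNReal.ofReal (√2 ^ (∏ l, r l) * Real.exp (-(u / 4))) := by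
  have hmeas : Measurable fun T : Tensor n =>
      ENNReal.ofReal (Real.exp (frobNorm (contraction T W) ^ 2 / 4)) := by
    simp only [frobNorm_sq]
    unfold contraction
    fun_prop
  have h := meas_ge_le_lintegral_div (μ := Measure.pi fun _ => gaussianReal 0 1)
    hmeas.aemeasurable (ε := ENNReal.ofReal (Real.exp (u / 4)))
    (by simp [Real.exp_pos]) ENNReal.ofReal_ne_top
  rw [lintegral_exp_frobNorm_contraction hW, ← ENNReal.ofReal_div_of_pos (Real.exp_pos _)] at h
  rw [Real.exp_neg, ← div_eq_mul_inv]
  refine le_trans (measure_mono fun T hT => ?_) h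
  refine ENNReal.ofReal_le_ofReal (Real.exp_le_exp.2 ?_)
  have : u < frobNorm (contraction T W) ^ 2 := hT
  linarith

/-- After translation by s, the density at x + s is at most e^(-s²/2) times that at x, for x > 0. -/
theorem gaussianReal_Ioi_le {s : ℝ} (hs : 0 ≤ s) :
    gaussianReal 0 1 (Set.Ioi s) ≤
      ENNReal.ofReal (Real.exp (-(s ^ 2 / 2))) * gaussianReal 0 1 (Set.Ioi 0) := by
  have h1 : gaussianReal 0 1 (Set.Ioi s) = gaussianReal (-s) 1 (Set.Ioi 0) := by
    have h := gaussianReal_map_add_const (μ := 0) (v := 1) (-s)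
    rw [zero_add] at h
    rw [← h, Measure.map_apply (by fun_prop) measurableSet_Ioi]
    congr 1
    ext x
    simp
  rw [h1, gaussianReal_apply _ one_ne_zero, gaussianReal_apply _ one_ne_zero,
    ← lintegral_const_mul _ (measurable_gaussianPDF 0 1)]
  refine setLIntegral_mono' measurableSet_Ioi fun x hx => ?_
  have hx0 : 0 < x := hx
  rw [gaussianPDF_def, gaussianPDF_def, ← ENNReal.ofReal_mul (Real.exp_pos _).le]
  refine ENNReal.ofReal_le_ofReal ?_
  rw [gaussianPDFReal_def, gaussianPDFReal_def]
  simp only [NNReal.coe_one, mul_one, sub_zero, sub_neg_eq_add]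
  rw [mul_left_comm, ← Real.exp_add]
  refine mul_le_mul_of_nonneg_left (Real.exp_le_exp.2 ?_) (by positivity)
  nlinarith [mul_nonneg hx0.le hs]

theorem gaussianReal_Iio_neg (s : ℝ) :
    gaussianReal 0 1 (Set.Iio (-s)) = gaussianReal 0 1 (Set.Ioi s) := by
  have h := gaussianReal_map_neg (μ := 0) (v := 1)
  rw [neg_zero] at h
  conv_lhs => rw [← h]
  rw [Measure.map_apply (by fun_prop) measurableSet_Iio]
  congr 1
  ext x
  simp

theorem gaussianReal_lt_sq_le {t : ℝ} (ht : 0 ≤ t) :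
    gaussianReal 0 1 {x | t < x ^ 2} ≤ ENNReal.ofReal (Real.exp (-(t / 2))) := by
  have hsub : {x : ℝ | t < x ^ 2} ⊆ Set.Iio (-√t) ∪ Set.Ioi √t := by
    intro x hx
    have h1 : √t < |x| := by
      rw [← Real.sqrt_sq_eq_abs]
      exact Real.sqrt_lt_sqrt ht hx
    rcases lt_abs.1 h1 with h | h
    · exact Or.inr h
    · exact Or.inl (show x < -√t by linarith)
  -- The two half-lines have total mass at most 1, so the two-sided tail carries no factor 2.
  have h0 : gaussianReal 0 1 (Set.Ioi 0) + gaussianReal 0 1 (Set.Ioi 0) ≤ 1 := by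
    conv_lhs => enter [1]; rw [← gaussianReal_Iio_neg, neg_zero]
    have hdisj : Disjoint (Set.Iio (0 : ℝ)) (Set.Ioi 0) :=
      Set.disjoint_left.2 fun x hx hx' => lt_asymm (Set.mem_Iio.1 hx) (Set.mem_Ioi.1 hx')
    rw [← measure_union hdisj measurableSet_Ioi]
    exact prob_le_one
  have h1 := gaussianReal_Ioi_le (Real.sqrt_nonneg t)
  rw [Real.sq_sqrt ht] at h1
  calc gaussianReal 0 1 {x | t < x ^ 2}
      ≤ gaussianReal 0 1 (Set.Iio (-√t)) + gaussianReal 0 1 (Set.Ioi √t) :=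
        (measure_mono hsub).trans (measure_union_le _ _)
    _ = gaussianReal 0 1 (Set.Ioi √t) + gaussianReal 0 1 (Set.Ioi √t) := by
        rw [gaussianReal_Iio_neg]
    _ ≤ ENNReal.ofReal (Real.exp (-(t / 2))) * gaussianReal 0 1 (Set.Ioi 0) +
        ENNReal.ofReal (Real.exp (-(t / 2))) * gaussianReal 0 1 (Set.Ioi 0) := add_le_add h1 h1
    _ ≤ ENNReal.ofReal (Real.exp (-(t / 2))) := by
        rw [← mul_add]
        exact mul_le_of_le_one_right' h0

end GaussianMoments

/-! ### Union bound and constants -/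

section SupremumBound

theorem measure_exists_stiefel_lt_le {d : ℕ} (hd : 1 ≤ d) {n r : Fin d → ℕ}
    (hrn : ∀ l, r l ≤ n l) {t : ℝ} (ht : 0 ≤ t) :
    (Measure.pi fun _ => gaussianReal 0 1) {T : Tensor n |
      ∃ A : (l : Fin d) → Matrix (Fin (n l)) (Fin (r l)) ℝ,
        (∀ l, A l ∈ stiefel (n l) (r l)) ∧ t < frobNorm (contraction T A) ^ 2} ≤
      ENNReal.ofReal ((11250 * d) ^ (∑ l, (r l * (n l - r l) + (r l).choose 2)) *
        (√2 ^ (∏ l, r l) * Real.exp (-(t / 16)))) := by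
  classical
  have hd' : (1 : ℝ) ≤ d := by exact_mod_cast hd
  have hε : (0 : ℝ) < 1 / (2 * d) := by positivity
  have hε1 : (1 : ℝ) / (2 * d) ≤ 1 := by
    rw [div_le_one (by positivity)]
    linarith
  choose N hNs hNcard hN using fun l => exists_stiefel_net (hrn l) hε hε1
  -- The factor 2 between supremum and net maximum becomes 4 after squaring; with the Markov
  -- exponent 1/4 this produces the 16.
  have hsub : {T : Tensor n | ∃ A : (l : Fin d) → Matrix (Fin (n l)) (Fin (r l)) ℝ,
      (∀ l, A l ∈ stiefel (n l) (r l)) ∧ t < frobNorm (contraction T A) ^ 2} ⊆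
      ⋃ B ∈ Fintype.piFinset N, {T : Tensor n | t / 4 < frobNorm (contraction T B) ^ 2} := by
    rintro T ⟨A, hA, hAt⟩
    by_contra hcon
    simp only [Set.mem_iUnion, Set.mem_ofPred_eq, not_exists, not_lt, Fintype.mem_piFinset] at hcon
    have h := frobNorm_contraction_le_two_mul hd hrn N hNs hN T (m := √(t / 4))
      (fun B hB => Real.le_sqrt_of_sq_le (hcon B hB)) A hA
    have h2 := pow_le_pow_left₀ (frobNorm_nonneg _) h 2
    rw [mul_pow, Real.sq_sqrt (by positivity)] at h2
    linarith
  have hcard : ((Fintype.piFinset N).card : ℝ) ≤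
      (11250 * d) ^ (∑ l, (r l * (n l - r l) + (r l).choose 2)) := by
    rw [Fintype.card_piFinset, Nat.cast_prod, ← Finset.prod_pow_eq_pow_sum]
    refine Finset.prod_le_prod (fun _ _ => Nat.cast_nonneg _) fun l _ => (hNcard l).trans_eq ?_
    congr 1
    field_simp
    norm_num
  calc _ ≤ ∑ B ∈ Fintype.piFinset N, (Measure.pi fun _ => gaussianReal 0 1)
          {T : Tensor n | t / 4 < frobNorm (contraction T B) ^ 2} :=
        (measure_mono hsub).trans (measure_biUnion_finset_le _ _)
    _ ≤ ∑ B ∈ Fintype.piFinset N,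
          ENNReal.ofReal (√2 ^ (∏ l, r l) * Real.exp (-(t / 16))) := by
        refine Finset.sum_le_sum fun B hB => ?_
        have h := measure_lt_frobNorm_contraction_sq_le
          (fun l => hNs l (B l) (Fintype.mem_piFinset.1 hB l)) (t / 4)
        rwa [div_div, show (4 : ℝ) * 4 = 16 by norm_num] at h
    _ = ENNReal.ofReal ((Fintype.piFinset N).card *
          (√2 ^ (∏ l, r l) * Real.exp (-(t / 16)))) := by
        rw [Finset.sum_const, nsmul_eq_mul, ENNReal.ofReal_mul (Nat.cast_nonneg _),
          ENNReal.ofReal_natCast]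
    _ ≤ _ := ENNReal.ofReal_le_ofReal (mul_le_mul_of_nonneg_right hcard (by positivity))

/-- Zero total dimension forces each mode to have r = 0 or r = n = 1. Either the contracted tensor
is empty, or the contraction is one Gaussian entry times factors of modulus at most 1. -/
theorem measure_exists_stiefel_lt_le_of_eq_zero {d : ℕ} {n r : Fin d → ℕ}
    (hrn : ∀ l, r l ≤ n l) (h0 : ∑ l, (r l * (n l - r l) + (r l).choose 2) = 0)
    {t : ℝ} (ht : 0 ≤ t) :
    (Measure.pi fun _ => gaussianReal 0 1) {T : Tensor n |
      ∃ A : (l : Fin d) → Matrix (Fin (n l)) (Fin (r l)) ℝ,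
        (∀ l, A l ∈ stiefel (n l) (r l)) ∧ t < frobNorm (contraction T A) ^ 2} ≤
      ENNReal.ofReal (Real.exp (-(t / 16))) ∧ ∏ l, r l ≤ 1 := by
  have hl : ∀ l, r l = 0 ∨ (r l = 1 ∧ n l = 1) := by
    intro l
    have h1 := (Finset.sum_eq_zero_iff.1 h0) l (Finset.mem_univ l)
    have h2 : r l < 2 := Nat.choose_eq_zero_iff.1 (by omega)
    have h3 : r l * (n l - r l) = 0 := by omega
    have h4 := hrn l
    rcases Nat.mul_eq_zero.1 h3 with h | h <;> omega
  constructor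
  · by_cases hz : ∃ l, r l = 0
    · obtain ⟨l, hl0⟩ := hz
      have hempty : IsEmpty ((l : Fin d) → Fin (r l)) := by
        refine ⟨fun j => ?_⟩
        have := (j l).2
        omega
      refine le_of_eq_of_le ?_ zero_le
      convert measure_empty (μ := Measure.pi fun _ : (l : Fin d) → Fin (n l) => gaussianReal 0 1)
      refine Set.eq_empty_of_forall_notMem ?_
      rintro T ⟨A, -, hAt⟩
      rw [frobNorm_sq, Finset.univ_eq_empty, Finset.sum_empty] at hAt
      exact absurd hAt ht.not_gt
    · push Not at hz
      obtain rfl : r = fun _ => 1 := funext fun l => ((hl l).resolve_left (hz l)).1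
      obtain rfl : n = fun _ => 1 := funext fun l => ((hl l).resolve_left (hz l)).2
      have hsub : {T : Tensor fun _ : Fin d => 1 |
          ∃ A : (l : Fin d) → Matrix (Fin 1) (Fin 1) ℝ,
            (∀ l, A l ∈ stiefel 1 1) ∧ t < frobNorm (contraction T A) ^ 2} ⊆
          (fun T => T default) ⁻¹' {x : ℝ | t < x ^ 2} := by
        rintro T ⟨A, hA, hAt⟩
        refine lt_of_lt_of_le hAt ?_
        rw [frobNorm_sq, Fintype.sum_unique, contraction, Fintype.sum_unique, ← sq_abs, abs_mul,
          ← sq_abs (T default), Finset.abs_prod]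
        refine pow_le_pow_left₀ (by positivity) (mul_le_of_le_one_right (abs_nonneg _) ?_) 2
        exact Finset.prod_le_one (fun _ _ => abs_nonneg _)
          fun l _ => abs_apply_le_one_of_mem_stiefel (hA l) _ _
      refine (measure_mono hsub).trans ?_
      have hmp := measurePreserving_eval
        (fun _ : (l : Fin d) → Fin 1 => gaussianReal 0 1) default
      rw [← Measure.map_apply (measurable_pi_apply _)
        (measurableSet_lt measurable_const (by fun_prop))]
      refine (le_of_eq (congrArg (fun μ : Measure ℝ => μ _) hmp.map_eq)).trans
        ((gaussianReal_lt_sq_le ht).trans (ENNReal.ofReal_le_ofReal (Real.exp_le_exp.2 ?_)))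
      linarith
  · refine Finset.prod_le_one' fun l _ => ?_
    rcases hl l with h | h <;> omega

theorem net_mul_moment_mul_exp_le {k p : ℕ} (hk : k ≠ 0) {d δ : ℝ} (hd : 1 ≤ d) (hδ : 0 < δ) :
    (11250 * d) ^ k * (√2 ^ p * Real.exp (-(16 * (k * Real.log (33750 * d / Real.log (3 / 2)) +
      Real.log (1 / δ * max 1 (Real.exp (1 / 2 * p - 1)))) / 16))) ≤ δ := by
  set q := max 1 (Real.exp (1 / 2 * p - 1)) with hq
  have hq1 : 1 ≤ q := le_max_left _ _
  have hlog : 0 < Real.log (3 / 2) := Real.log_pos (by norm_num)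
  have hlog1 : Real.log (3 / 2) ≤ 1 := by
    have := Real.log_le_sub_one_of_pos (show (0 : ℝ) < 3 / 2 by norm_num)
    linarith
  set X := 33750 * d / Real.log (3 / 2) with hX
  have hXpos : 0 < X := by positivity
  -- As log(3/2) ≤ 1, dividing by it only enlarges the base.
  have hXge : 33750 * d ≤ X := by
    rw [hX, le_div_iff₀ hlog]
    exact mul_le_of_le_one_right (by positivity) hlog1
  have hexp : Real.exp (-(16 * (k * Real.log X + Real.log (1 / δ * q)) / 16)) =
      (X ^ k)⁻¹ * (δ / q) := by
    rw [mul_div_cancel_left₀ _ (by norm_num), Real.exp_neg, Real.exp_add,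
      Real.exp_log (by positivity), ← Real.log_pow, Real.exp_log (by positivity), mul_inv]
    congr 1
    field_simp
  have h2 : √2 ≤ Real.exp (1 / 2) := by
    have h3 : √2 ≤ 3 / 2 := Real.sqrt_le_iff.2 ⟨by norm_num, by norm_num⟩
    linarith [Real.add_one_le_exp (1 / 2 : ℝ)]
  have h3 : √2 ^ p ≤ 3 ^ k * q := by
    calc √2 ^ p ≤ Real.exp (1 / 2) ^ p := pow_le_pow_left₀ (Real.sqrt_nonneg _) h2 p
      _ = Real.exp 1 * Real.exp (1 / 2 * p - 1) := by
          rw [← Real.exp_nat_mul, ← Real.exp_add]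
          congr 1
          ring
      _ ≤ 3 * q := mul_le_mul Real.exp_one_lt_three.le (le_max_right _ _) (Real.exp_pos _).le
          (by norm_num)
      _ ≤ 3 ^ k * q := by
          refine mul_le_mul_of_nonneg_right ?_ (by positivity)
          -- The only place where a positive dimension is essential.
          exact le_self_pow₀ (by norm_num) hk
  rw [hexp]
  calc (11250 * d) ^ k * (√2 ^ p * ((X ^ k)⁻¹ * (δ / q)))
      ≤ (11250 * d) ^ k * ((3 ^ k * q) * ((X ^ k)⁻¹ * (δ / q))) := by gcongr
    _ = (33750 * d) ^ k * (X ^ k)⁻¹ * δ := by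
        rw [show (33750 * d) ^ k = (11250 * d) ^ k * 3 ^ k by
          rw [← mul_pow]; congr 1; ring]
        field_simp
    _ ≤ 1 * δ := by
        refine mul_le_mul_of_nonneg_right ?_ hδ.le
        rw [← div_eq_mul_inv, div_le_one (by positivity)]
        exact pow_le_pow_left₀ (by positivity) hXge k
    _ = δ := one_mul δ

theorem sum_stiefel_dim_eq {d : ℕ} {n r : Fin d → ℕ} (hrn : ∀ l, r l ≤ n l) :
    ∑ l, (r l : ℝ) * ((n l : ℝ) - ((r l : ℝ) + 1) / 2) =
      ((∑ l, (r l * (n l - r l) + (r l).choose 2) : ℕ) : ℝ) := by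
  rw [Nat.cast_sum]
  refine Finset.sum_congr rfl fun l _ => ?_
  rw [Nat.cast_add, Nat.cast_choose_two, Nat.cast_mul, Nat.cast_sub (hrn l)]
  ring

theorem measure_exists_stiefel_lt_le_ofReal {d : ℕ} (hd : 1 ≤ d) {n r : Fin d → ℕ}
    (hrn : ∀ l, r l ≤ n l) {δ : ℝ} (hδ : 0 < δ) (hδ1 : δ < 1) :
    (Measure.pi fun _ => gaussianReal 0 1) {T : Tensor n |
      ∃ A : (l : Fin d) → Matrix (Fin (n l)) (Fin (r l)) ℝ,
        (∀ l, A l ∈ stiefel (n l) (r l)) ∧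
        16 * ((∑ l, (r l : ℝ) * ((n l : ℝ) - ((r l : ℝ) + 1) / 2)) *
              Real.log (33750 * (d : ℝ) / Real.log (3 / 2)) +
            Real.log (1 / δ * max 1 (Real.exp (1 / 2 * (∏ l, (r l : ℝ)) - 1)))) <
          frobNorm (contraction T A) ^ 2} ≤ ENNReal.ofReal δ := by
  have hd' : (1 : ℝ) ≤ d := by exact_mod_cast hd
  rw [sum_stiefel_dim_eq hrn, ← Nat.cast_prod]
  have hlog : 0 < Real.log (3 / 2) := Real.log_pos (by norm_num)
  have hlog1 : Real.log (3 / 2) ≤ 1 := by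
    have := Real.log_le_sub_one_of_pos (show (0 : ℝ) < 3 / 2 by norm_num)
    linarith
  have hX : 0 ≤ Real.log (33750 * (d : ℝ) / Real.log (3 / 2)) := by
    refine Real.log_nonneg ?_
    rw [le_div_iff₀ hlog]
    linarith
  have hδ' : 1 ≤ 1 / δ := by
    rw [one_le_div hδ]
    exact hδ1.le
  have hq : 0 ≤ Real.log (1 / δ * max 1 (Real.exp (1 / 2 * ((∏ l, r l : ℕ) : ℝ) - 1))) :=
    Real.log_nonneg (one_le_mul_of_one_le_of_one_le hδ' (le_max_left _ _))
  have ht := mul_nonneg (show (0 : ℝ) ≤ 16 by norm_num) (add_nonneg (mul_nonneg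
    (Nat.cast_nonneg (α := ℝ) (∑ l, (r l * (n l - r l) + (r l).choose 2))) hX) hq)
  by_cases h0 : ∑ l, (r l * (n l - r l) + (r l).choose 2) = 0
  · obtain ⟨h1, h2⟩ := measure_exists_stiefel_lt_le_of_eq_zero hrn h0 ht
    refine h1.trans (ENNReal.ofReal_le_ofReal ?_)
    have h3 : ((∏ l, r l : ℕ) : ℝ) ≤ 1 := by exact_mod_cast h2
    have h4 : max 1 (Real.exp (1 / 2 * ((∏ l, r l : ℕ) : ℝ) - 1)) = 1 :=
      max_eq_left (Real.exp_le_one_iff.2 (by linarith))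
    rw [h4, h0, mul_div_cancel_left₀ _ (by norm_num), Nat.cast_zero, zero_mul, zero_add, mul_one,
      one_div, Real.log_inv, neg_neg, Real.exp_log hδ]
  · exact (measure_exists_stiefel_lt_le hd hrn ht).trans
      (ENNReal.ofReal_le_ofReal (net_mul_moment_mul_exp_le h0 hd' hδ))

end SupremumBound

/-- The supremum is taken in the extended reals, so that no boundedness convention is involved. -/
theorem lemma4 :
    ∃ C : ℝ, 0 < C ∧
      ∀ (d : ℕ) (n r : Fin d → ℕ), 1 ≤ d → (∀ l, r l ≤ n l) →
      ∀ (Ω : Type*) [MeasurableSpace Ω] (P : Measure Ω) [IsProbabilityMeasure P]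
        (N : ((l : Fin d) → Fin (n l)) → Ω → ℝ),
        iIndepFun N P → (∀ i, HasLaw (N i) (gaussianReal 0 1) P) →
      ∀ δ : ℝ, 0 < δ →
        ENNReal.ofReal (1 - δ) ≤
          P {ω |
            (⨆ A : (l : Fin d) → stiefel (n l) (r l),
              ((frobNorm (contraction (fun i => N i ω) (fun l => (A l).1)) ^ 2 : ℝ) : EReal)) ≤
            ((16 * ((∑ l, (r l : ℝ) * ((n l : ℝ) - ((r l : ℝ) + 1) / 2)) *
                      Real.log (C * (d : ℝ) / Real.log (3 / 2)) +
                    Real.log (1 / δ *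
                      max 1 (Real.exp (1 / 2 * (∏ l, (r l : ℝ)) - 1)))) : ℝ) : EReal)} := by
  refine ⟨33750, by norm_num, fun d n r hd hrn Ω _ P _ N hN hlaw δ hδ => ?_⟩
  rcases le_or_gt 1 δ with hδ1 | hδ1
  · rw [ENNReal.ofReal_of_nonpos (by linarith)]
    exact zero_le
  have hmap : P.map (fun ω i => N i ω) = Measure.pi fun _ => gaussianReal 0 1 := by
    rw [(iIndepFun_iff_map_fun_eq_pi_map fun i => (hlaw i).aemeasurable).1 hN]
    congr 1
    funext i
    exact (hlaw i).map_eq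
  have hbad := measure_exists_stiefel_lt_le_ofReal hd hrn hδ hδ1
  rw [← hmap] at hbad
  -- The bad event is a union over uncountably many tuples. Its measurability is avoided: this
  -- inequality and the subadditivity below hold for arbitrary sets.
  have hbad' := (Measure.le_map_apply (aemeasurable_pi_lambda _ fun i => (hlaw i).aemeasurable) _).trans
    hbad
  rw [ENNReal.ofReal_sub _ hδ.le, ENNReal.ofReal_one, tsub_le_iff_right, ← measure_univ (μ := P)]
  refine (measure_mono ?_).trans ((measure_union_le _ _).trans (add_le_add_right hbad' _))
  intro ω _
  by_contra hcon
  rw [Set.mem_union, not_or] at hcon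
  refine hcon.1 (iSup_le fun A => EReal.coe_le_coe_iff.2 ?_)
  by_contra! hlt
  exact hcon.2 ⟨fun l => (A l).1, fun l => (A l).2, hlt⟩
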